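/- A continuous function $f:(0,\infty)\to\mathbb{R}$ is called operator monotone on $(0,\infty)$ if, for every complex Hilbert space $H$ and all bounded self-adjoint operators $S,T$ on $H$ with spectra in $(0,\infty)$, $S\le T$ implies $f(S)\le f(T)$. Such a function is differentiable. Let $\|\cdot\|$ denote the operator norm on $M_n(\mathbb{C})$, and let $|||\cdot|||$ be any unitarily invariant norm on $M_n(\mathbb{C})$, that is, a norm with $|||UYV|||=|||Y|||$ for all $Y\in M_n(\mathbb{C})$ and all unitary $U,V\in M_n(\mathbb{C})$. **Theorem.** Let $A,B,X\in M_n(\mathbb{C})$ with $A$ and $B$ positive definite, and let $f,g$ be two operator monotone functions on $(0,\infty)$. Then $$|||f(A)g(A)X-Xf(B)g(B)|||\le |||AX-XB|||\,\Big[\max\{\|f'(A)\|,\|f'(B)\|\}\,\max\{\|g(A)\|,\|g(B)\|\}+\max\{\|f(A)\|,\|f(B)\|\}\,\max\{\|g'(A)\|,\|g'(B)\|\}\Big].$$ -/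

import Mathlib

open scoped ComplexOrder

/-- A real function `f`, continuous on `I`, is operator monotone on `I` if `A ≤ B` implies
`f(A) ≤ f(B)` for all bounded self-adjoint operators `A`, `B` with spectra in `I` on a complex
Hilbert space (every one, finite or infinite dimensional). Here `≤` is the Loewner order and
`f(A) = cfc f A` is given by the continuous functional calculus. -/
def OperatorMonotoneOn (I : Set ℝ) (f : ℝ → ℝ) : Prop :=
  ContinuousOn f I ∧
    ∀ (H : Type) [NormedAddCommGroup H] [InnerProductSpace ℂ H] [CompleteSpace H]
      (A B : H →L[ℂ] H), IsSelfAdjoint A → IsSelfAdjoint B →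
      spectrum ℝ A ⊆ I → spectrum ℝ B ⊆ I → A ≤ B → cfc f A ≤ cfc f B

/-- `N` is a unitarily invariant norm on `M_n(ℂ)`: a seminorm that vanishes only at `0`, with
`N (U A V) = N A` for all unitary `U`, `V`. -/
structure IsUnitarilyInvariantNorm {n : ℕ} (N : Seminorm ℂ (Matrix (Fin n) (Fin n) ℂ)) :
    Prop where
  eq_zero_of_apply_eq_zero : ∀ A : Matrix (Fin n) (Fin n) ℂ, N A = 0 → A = 0
  apply_unitary_mul_mul_unitary : ∀ A : Matrix (Fin n) (Fin n) ℂ,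
    ∀ U ∈ Matrix.unitaryGroup (Fin n) ℂ, ∀ V ∈ Matrix.unitaryGroup (Fin n) ℂ,
      N (U * A * V) = N A

/-- The operator norm of a matrix acting on the Euclidean space `ℂⁿ`. -/
noncomputable def matrixOpNorm {n : ℕ} (A : Matrix (Fin n) (Fin n) ℂ) : ℝ :=
  ‖Matrix.toEuclideanCLM (n := Fin n) (𝕜 := ℂ) A‖

/-! The product splits by a Leibniz rule, f(A)g(A)X − Xf(B)g(B) = (f(A)X − Xf(B))g(B) + f(A)(g(A)X −
Xg(B)). Since |||CY||| ≤ ‖C‖ |||Y||| and |||YC||| ≤ |||Y||| ‖C‖, everything rests on the bound for a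
single function, |||f(A)X − Xf(B)||| ≤ max(‖f'(A)‖, ‖f'(B)‖) |||AX − XB|||
(`apply_cfc_mul_sub_mul_cfc_le`).

In eigenbases of A and B, with eigenvalues a_i and b_j, passing from AX − XB to f(A)X − Xf(B)
multiplies the (i, j) entry by the divided difference f[a_i, b_j]. These numbers form an
off-diagonal block of the Loewner matrix of f at the points a, b together. That matrix is positive
semidefinite, hence a Gram matrix, and its diagonal consists of values of f'. A Schur multiplier of
Gram type has norm at most the largest squared length of its vectors, in every unitarily invariant
norm (`apply_schur_le`): it maps singular values through a matrix with bounded absolute row and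
column sums, and Birkhoff's theorem applies.

Positivity of the Loewner matrix comes from differentiating t ↦ f(D + tJ) at t = 0, with D diagonal
and J ≥ 0 the all-ones matrix. Differentiability of f is proved, not assumed: f is monotone, hence
differentiable almost everywhere, and concave, and the 2 × 2 Loewner inequality at points of
differentiability excludes corners. -/

/-! ### Unitarily invariant norms: singular values, averages of unitaries, Birkhoff's theorem. -/

section UnitarilyInvariant

variable {n : ℕ}

/-- Singular value decomposition of a square complex matrix. -/
theorem exists_singular_value_decomposition (Z : Matrix (Fin n) (Fin n) ℂ) :
    ∃ U ∈ Matrix.unitaryGroup (Fin n) ℂ, ∃ V ∈ Matrix.unitaryGroup (Fin n) ℂ, ∃ s : Fin n → ℂ,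
      Z = U * Matrix.diagonal s * V := by
  have hH : (Z.conjTranspose * Z).IsHermitian := Matrix.isHermitian_conjTranspose_mul_self Z
  set v := hH.eigenvectorBasis with hv
  set T := Matrix.toEuclideanLin Z with hT
  have hinner : ∀ i j, inner ℂ (T (v i)) (T (v j)) = (hH.eigenvalues j : ℂ) * inner ℂ (v i) (v j) := by
    intro i j
    have h1 : inner ℂ (T (v i)) (T (v j)) =
        inner ℂ (v i) (Matrix.toEuclideanLin (Z.conjTranspose * Z) (v j)) := by
      rw [Matrix.toLpLin_mul_same, LinearMap.comp_apply, Matrix.toEuclideanLin_conjTranspose_eq_adjoint,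
        LinearMap.adjoint_inner_right]
    rw [h1, show Matrix.toEuclideanLin (Z.conjTranspose * Z) (v j)
      = (hH.eigenvalues j : ℂ) • v j from ?_, inner_smul_right]
    have := hH.mulVec_eigenvectorBasis j
    ext k
    have := congrFun this k
    simpa using this
  -- The vectors T(v i) are orthogonal; the nonzero ones, normalized, extend to an orthonormal basis
  -- of left singular vectors.
  let w : Fin n → EuclideanSpace ℂ (Fin n) := fun i => ((‖T (v i)‖ : ℂ))⁻¹ • T (v i)
  have hw : Orthonormal ℂ (({i | T (v i) ≠ 0} : Set (Fin n)).domRestrict w) := by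
    constructor
    · rintro ⟨i, hi⟩
      have : ‖T (v i)‖ ≠ 0 := norm_ne_zero_iff.2 hi
      simp [w, norm_smul, this]
    · rintro ⟨i, hi⟩ ⟨j, hj⟩ hij
      have hij' : i ≠ j := fun h => hij (Subtype.ext h)
      have : inner ℂ (v i) (v j) = 0 := v.orthonormal.2 hij'
      simp [w, inner_smul_left, inner_smul_right, hinner, this]
  obtain ⟨b, hb⟩ := hw.exists_orthonormalBasis_extension_of_card_eq (by simp)
  have hTv : ∀ i, T (v i) = (‖T (v i)‖ : ℂ) • b i := by
    intro i
    by_cases hi : T (v i) = 0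
    · simp [hi]
    · have : (‖T (v i)‖ : ℂ) ≠ 0 := by simpa using hi
      rw [hb i hi, smul_smul, mul_inv_cancel₀ this, one_smul]
  let e := EuclideanSpace.basisFun (Fin n) ℂ
  let U := e.toBasis.toMatrix b
  let V := e.toBasis.toMatrix v
  have hU : U ∈ Matrix.unitaryGroup (Fin n) ℂ := e.toMatrix_orthonormalBasis_mem_unitary b
  have hV : V ∈ Matrix.unitaryGroup (Fin n) ℂ := e.toMatrix_orthonormalBasis_mem_unitary v
  refine ⟨U, hU, star V, Unitary.star_mem hV, fun i => (‖T (v i)‖ : ℂ), ?_⟩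
  have hZV : Z * V = U * Matrix.diagonal fun i => (‖T (v i)‖ : ℂ) := by
    ext i j
    have := congrArg (fun x : EuclideanSpace ℂ (Fin n) => x i) (hTv j)
    rw [Matrix.mul_diagonal]
    simp only [hT] at this
    simpa [Matrix.mul_apply, Matrix.mulVec, dotProduct, U, V, e, Module.Basis.toMatrix_apply,
      mul_comm] using this
  rw [← hZV, mul_assoc, Matrix.mem_unitaryGroup_iff.1 hV, mul_one]

/-- A point of the disc of radius c is the midpoint of a chord of the circle; its ends have
arguments arg s ± arccos(‖s‖/c). -/
theorem exists_pair_norm_eq_one_add_eq {c : ℝ} {s : ℂ} (hs : ‖s‖ ≤ c) :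
    ∃ z w : ℂ, ‖z‖ = 1 ∧ ‖w‖ = 1 ∧ s = (c / 2 : ℂ) * (z + w) := by
  rcases (norm_nonneg s).trans hs |>.eq_or_lt with hc | hc
  · refine ⟨1, 1, by simp, by simp, ?_⟩
    have : s = 0 := norm_le_zero_iff.1 (hc ▸ hs)
    simp [this, ← hc]
  · set θ := Real.arccos (‖s‖ / c) with hθ
    have hcos : Real.cos θ = ‖s‖ / c :=
      Real.cos_arccos (by have := norm_nonneg s; have := div_nonneg this hc.le; linarith)
        (div_le_one_of_le₀ hs hc.le)
    refine ⟨Complex.exp (s.arg * Complex.I) * Complex.exp (θ * Complex.I),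
      Complex.exp (s.arg * Complex.I) * Complex.exp ((-θ : ℝ) * Complex.I), ?_, ?_, ?_⟩
    · simp [Complex.norm_exp_ofReal_mul_I]
    · rw [norm_mul, Complex.norm_exp_ofReal_mul_I, Complex.norm_exp_ofReal_mul_I, one_mul]
    · have h2 : Complex.exp (θ * Complex.I) + Complex.exp ((-θ : ℝ) * Complex.I)
          = 2 * (‖s‖ / c : ℂ) := by
        have : (Real.cos θ : ℂ) = (‖s‖ / c : ℂ) := by rw [hcos]; push_cast; rfl
        rw [← this, Complex.ofReal_cos, Complex.cos]
        push_cast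
        ring
      rw [← mul_add, h2]
      have hc' : (c : ℂ) ≠ 0 := by exact_mod_cast hc.ne'
      conv_lhs => rw [← Complex.norm_mul_exp_arg_mul_I s]
      field_simp

theorem diagonal_mem_unitaryGroup {z : Fin n → ℂ} (hz : ∀ i, ‖z i‖ = 1) :
    Matrix.diagonal z ∈ Matrix.unitaryGroup (Fin n) ℂ := by
  rw [Matrix.mem_unitaryGroup_iff, Matrix.star_eq_conjTranspose, Matrix.diagonal_conjTranspose,
    Matrix.diagonal_mul_diagonal, ← Matrix.diagonal_one]
  congr 1
  ext i
  simp [Complex.mul_conj, Complex.normSq_eq_norm_sq, hz i]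

/-- Averaging over unimodular diagonal matrices. -/
theorem Seminorm.apply_mul_diagonal_mul_le (N : Seminorm ℂ (Matrix (Fin n) (Fin n) ℂ))
    (P Q : Matrix (Fin n) (Fin n) ℂ) (s : Fin n → ℂ) {c M : ℝ} (hc : 0 ≤ c)
    (hs : ∀ i, ‖s i‖ ≤ c)
    (h : ∀ z : Fin n → ℂ, (∀ i, ‖z i‖ = 1) → N (P * Matrix.diagonal z * Q) ≤ M) :
    N (P * Matrix.diagonal s * Q) ≤ c * M := by
  choose z w hz hw hzw using fun i => exists_pair_norm_eq_one_add_eq (hs i)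
  have : P * Matrix.diagonal s * Q = (c / 2 : ℂ) •
      (P * Matrix.diagonal z * Q + P * Matrix.diagonal w * Q) := by
    have : Matrix.diagonal s = (c / 2 : ℂ) • (Matrix.diagonal z + Matrix.diagonal w) := by
      rw [Matrix.diagonal_add, ← Matrix.diagonal_smul]
      congr 1
      ext i
      simp [hzw i]
    rw [this, Matrix.mul_smul, Matrix.smul_mul, mul_add, add_mul]
  rw [this, map_smul_eq_mul]
  have h1 := map_add_le_add N (P * Matrix.diagonal z * Q) (P * Matrix.diagonal w * Q)
  have h2 := h z hz
  have h3 := h w hw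
  have h4 : ‖(c / 2 : ℂ)‖ = c / 2 := by
    rw [norm_div, Complex.norm_real, Real.norm_of_nonneg hc]; norm_num
  rw [h4]
  calc c / 2 * _ ≤ c / 2 * (M + M) := by gcongr; linarith
    _ = c * M := by ring

namespace IsUnitarilyInvariantNorm

variable {N : Seminorm ℂ (Matrix (Fin n) (Fin n) ℂ)}

theorem apply_unitary_mul (hN : IsUnitarilyInvariantNorm N) (Y : Matrix (Fin n) (Fin n) ℂ)
    {U : Matrix (Fin n) (Fin n) ℂ} (hU : U ∈ Matrix.unitaryGroup (Fin n) ℂ) :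
    N (U * Y) = N Y := by
  simpa using hN.apply_unitary_mul_mul_unitary Y U hU 1 (one_mem _)

theorem apply_mul_unitary (hN : IsUnitarilyInvariantNorm N) (Y : Matrix (Fin n) (Fin n) ℂ)
    {U : Matrix (Fin n) (Fin n) ℂ} (hU : U ∈ Matrix.unitaryGroup (Fin n) ℂ) :
    N (Y * U) = N Y := by
  simpa using hN.apply_unitary_mul_mul_unitary Y 1 (one_mem _) U hU

end IsUnitarilyInvariantNorm

open scoped Matrix.Norms.L2Operator in
theorem norm_apply_le_of_unitary_mul_diagonal_mul {U V : Matrix (Fin n) (Fin n) ℂ}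
    (hU : U ∈ Matrix.unitaryGroup (Fin n) ℂ) (hV : V ∈ Matrix.unitaryGroup (Fin n) ℂ)
    (s : Fin n → ℂ) (i : Fin n) : ‖s i‖ ≤ matrixOpNorm (U * Matrix.diagonal s * V) := by
  have h1 : matrixOpNorm (U * Matrix.diagonal s * V) = ‖U * Matrix.diagonal s * V‖ := rfl
  rw [h1, CStarRing.norm_mul_mem_unitary _ hV, CStarRing.norm_mem_unitary_mul _ hU,
    Matrix.l2_opNorm_diagonal]
  exact norm_le_pi_norm s i

theorem matrixOpNorm_nonneg (C : Matrix (Fin n) (Fin n) ℂ) : 0 ≤ matrixOpNorm C := norm_nonneg _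

namespace IsUnitarilyInvariantNorm

variable {N : Seminorm ℂ (Matrix (Fin n) (Fin n) ℂ)}

/-- By singular values, C is ‖C‖ times the average of two unitaries, and each of these preserves the
norm. -/
theorem apply_mul_le_left (hN : IsUnitarilyInvariantNorm N) (C Y : Matrix (Fin n) (Fin n) ℂ) :
    N (C * Y) ≤ matrixOpNorm C * N Y := by
  obtain ⟨U, hU, V, hV, s, hs⟩ := exists_singular_value_decomposition C
  have h : N (U * Matrix.diagonal s * (V * Y)) ≤ matrixOpNorm C * N Y := by
    refine N.apply_mul_diagonal_mul_le _ _ s (matrixOpNorm_nonneg _) (fun i => ?_) fun z hz => ?_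
    · rw [hs]; exact norm_apply_le_of_unitary_mul_diagonal_mul hU hV s i
    · rw [hN.apply_unitary_mul _ (mul_mem hU (diagonal_mem_unitaryGroup hz)),
        hN.apply_unitary_mul _ hV]
  rwa [← mul_assoc, ← hs] at h

theorem apply_mul_le_right (hN : IsUnitarilyInvariantNorm N) (Y C : Matrix (Fin n) (Fin n) ℂ) :
    N (Y * C) ≤ N Y * matrixOpNorm C := by
  obtain ⟨U, hU, V, hV, s, hs⟩ := exists_singular_value_decomposition C
  have h : N (Y * U * Matrix.diagonal s * V) ≤ matrixOpNorm C * N Y := by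
    refine N.apply_mul_diagonal_mul_le _ _ s (matrixOpNorm_nonneg _) (fun i => ?_) fun z hz => ?_
    · rw [hs]; exact norm_apply_le_of_unitary_mul_diagonal_mul hU hV s i
    · rw [hN.apply_mul_unitary _ hV, hN.apply_mul_unitary _ (diagonal_mem_unitaryGroup hz),
        hN.apply_mul_unitary _ hU]
  rw [mul_comm]
  rwa [mul_assoc, mul_assoc, ← mul_assoc U, ← hs] at h

theorem apply_diagonal_comp_perm (hN : IsUnitarilyInvariantNorm N) (t : Fin n → ℂ)
    (σ : Equiv.Perm (Fin n)) :
    N (Matrix.diagonal fun i => t (σ i)) = N (Matrix.diagonal t) := by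
  have hσ : σ.permMatrix ℂ ∈ Matrix.unitaryGroup (Fin n) ℂ := by
    rw [Matrix.mem_unitaryGroup_iff, Matrix.star_eq_conjTranspose, Matrix.conjTranspose_permMatrix,
      ← Matrix.permMatrix_mul]
    simp
  have h : (Matrix.diagonal fun i => t (σ i)) =
      σ.permMatrix ℂ * Matrix.diagonal t * star (σ.permMatrix ℂ) := by
    have h2 : σ.permMatrix ℂ * Matrix.diagonal t =
        (Matrix.diagonal fun i => t (σ i)) * σ.permMatrix ℂ := by
      ext i j
      rw [Matrix.mul_diagonal, Matrix.diagonal_mul]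
      by_cases hij : σ i = j
      · subst hij; rw [mul_comm]
      · simp [Equiv.Perm.permMatrix, Equiv.toPEquiv, PEquiv.toMatrix_apply, hij]
    rw [h2, mul_assoc, Matrix.mem_unitaryGroup_iff.1 hσ, mul_one]
  rw [h, hN.apply_unitary_mul_mul_unitary _ _ hσ _ (Unitary.star_mem hσ)]

end IsUnitarilyInvariantNorm

/-- A doubly substochastic matrix is dominated by a doubly stochastic one. -/
theorem exists_doublyStochastic_ge {ι : Type*} [Fintype ι] [DecidableEq ι] (a : ι → ι → ℝ)
    (ha : ∀ i j, 0 ≤ a i j) (hrow : ∀ i, ∑ j, a i j ≤ 1) (hcol : ∀ j, ∑ i, a i j ≤ 1) :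
    ∃ S ∈ doublyStochastic ℝ ι, ∀ i j, a i j ≤ S i j := by
  set r : ι → ℝ := fun i => 1 - ∑ j, a i j with hr
  set d : ι → ℝ := fun j => 1 - ∑ i, a i j with hd
  have hr0 : ∀ i, 0 ≤ r i := fun i => sub_nonneg.2 (hrow i)
  have hd0 : ∀ i, 0 ≤ d i := fun i => sub_nonneg.2 (hcol i)
  set τ := ∑ i, r i with hτ
  have hτd : ∑ j, d j = τ := by
    simp only [hτ, hr, hd, Finset.sum_sub_distrib]
    rw [Finset.sum_comm]
  have hτ0 : 0 ≤ τ := Finset.sum_nonneg fun i _ => hr0 i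
  have hrτ : ∀ i, r i * τ / τ = r i := by
    intro i
    by_cases h : τ = 0
    · have := (Finset.sum_eq_zero_iff_of_nonneg fun i _ => hr0 i).1 h i (Finset.mem_univ i)
      simp [this]
    · field_simp
  have hdτ : ∀ i, τ * d i / τ = d i := by
    intro i
    by_cases h : τ = 0
    · have := (Finset.sum_eq_zero_iff_of_nonneg fun i _ => hd0 i).1 (hτd.trans h) i
        (Finset.mem_univ i)
      simp [this]
    · field_simp
  have hnn : ∀ i j, 0 ≤ r i * d j / τ := fun i j => div_nonneg (mul_nonneg (hr0 i) (hd0 j)) hτ0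
  -- The row deficits r and column deficits d have the same total τ, so the rank-one matrix r i * d
  -- j / τ fills both. If τ = 0 all deficits vanish and 0 / 0 = 0 does no harm.
  refine ⟨Matrix.of fun i j => a i j + r i * d j / τ, ?_, fun i j => ?_⟩
  · rw [mem_doublyStochastic_iff_sum]
    refine ⟨fun i j => add_nonneg (ha i j) (hnn i j), fun i => ?_, fun j => ?_⟩
    · simp only [Matrix.of_apply, Finset.sum_add_distrib]
      rw [← Finset.sum_div, ← Finset.mul_sum, hτd, hrτ]
      simp [hr]
    · simp only [Matrix.of_apply, Finset.sum_add_distrib]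
      rw [← Finset.sum_div, ← Finset.sum_mul, ← hτ, hdτ]
      simp [hd]
  · simpa using hnn i j

namespace IsUnitarilyInvariantNorm

variable {N : Seminorm ℂ (Matrix (Fin n) (Fin n) ℂ)}

/-- Write m as S with each entry scaled by a factor of modulus at most 1, where S is doubly
stochastic. Birkhoff makes S a convex combination of permutations; for each one, `t` is permuted and
then multiplied by a diagonal contraction, which does not increase the norm. -/
theorem apply_diagonal_sum_le_of_substochastic (hN : IsUnitarilyInvariantNorm N)
    (m : Fin n → Fin n → ℂ) (t : Fin n → ℂ)
    (hrow : ∀ i, ∑ j, ‖m i j‖ ≤ 1) (hcol : ∀ j, ∑ i, ‖m i j‖ ≤ 1) :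
    N (Matrix.diagonal fun i => ∑ j, m i j * t j) ≤ N (Matrix.diagonal t) := by
  obtain ⟨S, hS, hmS⟩ := exists_doublyStochastic_ge (fun i j => ‖m i j‖)
    (fun i j => norm_nonneg _) hrow hcol
  obtain ⟨w, hw0, hw1, hwS⟩ := exists_eq_sum_perm_of_mem_doublyStochastic hS
  have hz : ∀ i j, ‖m i j / S i j‖ ≤ 1 := by
    intro i j
    have h0 : 0 ≤ S i j := (norm_nonneg _).trans (hmS i j)
    rw [norm_div, Complex.norm_real, Real.norm_of_nonneg h0]
    exact div_le_one_of_le₀ (hmS i j) h0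
  have hm : ∀ i j, m i j = m i j / S i j * S i j := by
    intro i j
    by_cases h : S i j = 0
    · have : m i j = 0 := norm_le_zero_iff.1 (h ▸ hmS i j)
      simp [this]
    · have : (S i j : ℂ) ≠ 0 := by exact_mod_cast h
      field_simp
  have hSw : ∀ i j, S i j = ∑ σ : Equiv.Perm (Fin n), w σ * if σ i = j then 1 else 0 := by
    intro i j
    rw [← hwS, Matrix.sum_apply]
    refine Finset.sum_congr rfl fun σ _ => ?_
    simp [Equiv.Perm.permMatrix, Equiv.toPEquiv, PEquiv.toMatrix_apply, eq_comm]
  have key : (Matrix.diagonal fun i => ∑ j, m i j * t j) = ∑ σ : Equiv.Perm (Fin n),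
      (w σ : ℂ) • (1 * Matrix.diagonal (fun i => m i (σ i) / S i (σ i)) *
        Matrix.diagonal fun i => t (σ i)) := by
    ext i k
    rw [Matrix.sum_apply]
    by_cases hik : i = k
    · subst hik
      simp only [Matrix.diagonal_apply_eq, one_mul, Matrix.diagonal_mul_diagonal, Matrix.smul_apply,
        smul_eq_mul]
      calc ∑ j, m i j * t j
          = ∑ j, ∑ σ : Equiv.Perm (Fin n),
              (w σ : ℂ) * if σ i = j then m i j / S i j * t j else 0 := by
            refine Finset.sum_congr rfl fun j _ => ?_
            conv_lhs => rw [hm i j]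
            nth_rw 2 [hSw i j]
            push_cast
            rw [Finset.mul_sum, Finset.sum_mul]
            refine Finset.sum_congr rfl fun σ _ => ?_
            split_ifs <;> push_cast <;> ring
        _ = _ := by
            rw [Finset.sum_comm]
            refine Finset.sum_congr rfl fun σ _ => ?_
            rw [← Finset.mul_sum]
            simp
    · simp [hik]
  rw [key]
  calc N (∑ σ : Equiv.Perm (Fin n), _) ≤ ∑ σ : Equiv.Perm (Fin n), N _ := Finset.le_sum_of_subadditive N (map_zero N).le (map_add_le_add N) _ _
    _ ≤ ∑ σ : Equiv.Perm (Fin n), w σ * N (Matrix.diagonal t) := by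
        refine Finset.sum_le_sum fun σ _ => ?_
        rw [map_smul_eq_mul, Complex.norm_real, Real.norm_of_nonneg (hw0 σ)]
        refine mul_le_mul_of_nonneg_left ?_ (hw0 σ)
        rw [← one_mul (N (Matrix.diagonal t))]
        refine N.apply_mul_diagonal_mul_le _ _ _ zero_le_one (fun i => hz i _) fun z hz => ?_
        rw [one_mul, hN.apply_unitary_mul _ (diagonal_mem_unitaryGroup hz),
          hN.apply_diagonal_comp_perm]
    _ = N (Matrix.diagonal t) := by rw [← Finset.sum_mul, hw1, one_mul]

theorem apply_diagonal_sum_le (hN : IsUnitarilyInvariantNorm N)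
    (m : Fin n → Fin n → ℂ) (t : Fin n → ℂ) {c : ℝ} (hc : 0 ≤ c)
    (hrow : ∀ i, ∑ j, ‖m i j‖ ≤ c) (hcol : ∀ j, ∑ i, ‖m i j‖ ≤ c) :
    N (Matrix.diagonal fun i => ∑ j, m i j * t j) ≤ c * N (Matrix.diagonal t) := by
  rcases hc.eq_or_lt with rfl | hc
  · have hm : ∀ i j, m i j = 0 := fun i j => norm_le_zero_iff.1
      ((Finset.single_le_sum (f := fun j => ‖m i j‖) (fun _ _ => norm_nonneg _)
        (Finset.mem_univ j)).trans (hrow i))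
    simp [hm]
  · have h := hN.apply_diagonal_sum_le_of_substochastic (fun i j => (c : ℂ)⁻¹ * m i j) t
      (fun i => ?_) (fun j => ?_)
    · have h2 : (Matrix.diagonal fun i => ∑ j, m i j * t j) =
          (c : ℂ) • Matrix.diagonal fun i => ∑ j, ((c : ℂ)⁻¹ * m i j) * t j := by
        have : (c : ℂ) ≠ 0 := by exact_mod_cast hc.ne'
        rw [← Matrix.diagonal_smul]
        congr 1
        ext i
        simp only [Pi.smul_apply, smul_eq_mul, Finset.mul_sum]
        refine Finset.sum_congr rfl fun j _ => ?_
        field_simp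
      rw [h2, map_smul_eq_mul, Complex.norm_real, Real.norm_of_nonneg hc.le]
      gcongr
    · simp only [norm_mul, norm_inv, Complex.norm_real, Real.norm_of_nonneg hc.le]
      rw [← Finset.mul_sum, inv_mul_le_one₀ hc]
      exact hrow i
    · simp only [norm_mul, norm_inv, Complex.norm_real, Real.norm_of_nonneg hc.le]
      rw [← Finset.mul_sum, inv_mul_le_one₀ hc]
      exact hcol j

end IsUnitarilyInvariantNorm

/-! ### Schur multipliers of Gram type. -/

theorem sum_norm_sq_vecMul_unitary {V : Matrix (Fin n) (Fin n) ℂ}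
    (hV : V ∈ Matrix.unitaryGroup (Fin n) ℂ) (x : Fin n → ℂ) :
    ∑ j, ‖(Matrix.vecMul x V) j‖ ^ 2 = ∑ j, ‖x j‖ ^ 2 := by
  have h : ∀ y : Fin n → ℂ, ((∑ j, ‖y j‖ ^ 2 : ℝ) : ℂ) = dotProduct y (star y) := by
    intro y
    simp [dotProduct, Complex.mul_conj, Complex.normSq_eq_norm_sq]
  have h2 : dotProduct (Matrix.vecMul x V) (star (Matrix.vecMul x V)) = dotProduct x (star x) := by
    rw [Matrix.star_vecMul, Matrix.dotProduct_mulVec, Matrix.vecMul_vecMul,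
      ← Matrix.star_eq_conjTranspose, Matrix.mem_unitaryGroup_iff.1 hV, Matrix.vecMul_one]
  exact_mod_cast (h _).trans (h2.trans (h _).symm)

theorem sum_norm_sq_unitary_row {U : Matrix (Fin n) (Fin n) ℂ}
    (hU : U ∈ Matrix.unitaryGroup (Fin n) ℂ) (i : Fin n) : ∑ a, ‖U i a‖ ^ 2 = 1 := by
  have := sum_norm_sq_vecMul_unitary hU (Pi.single i 1)
  simpa [Matrix.single_vecMul, Pi.single_apply, apply_ite, Finset.sum_ite_eq'] using this

theorem sum_norm_sq_row_unitary_mul_diagonal_mul {U V : Matrix (Fin n) (Fin n) ℂ}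
    (hV : V ∈ Matrix.unitaryGroup (Fin n) ℂ) (d : Fin n → ℂ) (i : Fin n) :
    ∑ j, ‖(U * Matrix.diagonal d * V) i j‖ ^ 2 = ∑ a, ‖U i a‖ ^ 2 * ‖d a‖ ^ 2 := by
  have := sum_norm_sq_vecMul_unitary hV ((U * Matrix.diagonal d) i)
  simp only [Matrix.mul_diagonal, norm_mul, mul_pow] at this
  rw [← this]
  rfl

theorem transpose_mem_unitaryGroup {U : Matrix (Fin n) (Fin n) ℂ}
    (hU : U ∈ Matrix.unitaryGroup (Fin n) ℂ) : U.transpose ∈ Matrix.unitaryGroup (Fin n) ℂ := by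
  have h : U.transpose * star U.transpose = (star U * U).transpose := by
    rw [Matrix.transpose_mul]; rfl
  rw [Matrix.mem_unitaryGroup_iff, h, Matrix.mem_unitaryGroup_iff'.1 hU, Matrix.transpose_one]

theorem sum_sum_norm_sq_row_le {κ : Type*} [Fintype κ] {U V : Matrix (Fin n) (Fin n) ℂ}
    (hU : U ∈ Matrix.unitaryGroup (Fin n) ℂ) (hV : V ∈ Matrix.unitaryGroup (Fin n) ℂ)
    (p : κ → Fin n → ℂ) {c : ℝ} (hp : ∀ a, ∑ k, ‖p k a‖ ^ 2 ≤ c) (i : Fin n) :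
    ∑ j, ∑ k, ‖(U * Matrix.diagonal (p k) * V) i j‖ ^ 2 ≤ c := by
  rw [Finset.sum_comm]
  simp only [sum_norm_sq_row_unitary_mul_diagonal_mul hV]
  rw [Finset.sum_comm]
  simp only [← Finset.mul_sum]
  calc ∑ a, ‖U i a‖ ^ 2 * ∑ k, ‖p k a‖ ^ 2 ≤ ∑ a, ‖U i a‖ ^ 2 * c := by
        gcongr with a; exact hp a
    _ = c := by rw [← Finset.sum_mul, sum_norm_sq_unitary_row hU, one_mul]

theorem sum_sum_norm_sq_col_le {κ : Type*} [Fintype κ] {U V : Matrix (Fin n) (Fin n) ℂ}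
    (hU : U ∈ Matrix.unitaryGroup (Fin n) ℂ) (hV : V ∈ Matrix.unitaryGroup (Fin n) ℂ)
    (p : κ → Fin n → ℂ) {c : ℝ} (hp : ∀ a, ∑ k, ‖p k a‖ ^ 2 ≤ c) (j : Fin n) :
    ∑ i, ∑ k, ‖(U * Matrix.diagonal (p k) * V) i j‖ ^ 2 ≤ c := by
  have := sum_sum_norm_sq_row_le (transpose_mem_unitaryGroup hV) (transpose_mem_unitaryGroup hU)
    p hp j
  have h : ∀ k, V.transpose * Matrix.diagonal (p k) * U.transpose =
      (U * Matrix.diagonal (p k) * V).transpose := by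
    intro k
    rw [Matrix.transpose_mul, Matrix.transpose_mul, Matrix.diagonal_transpose, mul_assoc]
  simpa only [h, Matrix.transpose_apply] using this

theorem norm_sum_mul_le_half {κ : Type*} [Fintype κ] (x y : κ → ℂ) :
    ‖∑ k, x k * y k‖ ≤ (∑ k, ‖x k‖ ^ 2 + ∑ k, ‖y k‖ ^ 2) / 2 := by
  rw [← Finset.sum_add_distrib, Finset.sum_div]
  refine (norm_sum_le _ _).trans (Finset.sum_le_sum fun k _ => ?_)
  rw [norm_mul]
  nlinarith [sq_nonneg (‖x k‖ - ‖y k‖)]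

namespace IsUnitarilyInvariantNorm

variable {N : Seminorm ℂ (Matrix (Fin n) (Fin n) ℂ)}

/-- A Schur multiplier of Gram type is bounded in every unitarily invariant norm. -/
theorem apply_schur_le (hN : IsUnitarilyInvariantNorm N) {κ : Type*} [Fintype κ]
    (p q : κ → Fin n → ℂ) {c : ℝ} (hc : 0 ≤ c) (hp : ∀ a, ∑ k, ‖p k a‖ ^ 2 ≤ c)
    (hq : ∀ a, ∑ k, ‖q k a‖ ^ 2 ≤ c) (Y : Matrix (Fin n) (Fin n) ℂ) :
    N (Matrix.of fun i j => (∑ k, p k i * q k j) * Y i j) ≤ c * N Y := by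
  set Z : Matrix (Fin n) (Fin n) ℂ := Matrix.of fun i j => (∑ k, p k i * q k j) * Y i j with hZ
  have hZ' : Z = ∑ k, Matrix.diagonal (p k) * Y * Matrix.diagonal (q k) := by
    ext i j
    simp only [hZ, Matrix.of_apply, Matrix.sum_apply, Matrix.mul_diagonal, Matrix.diagonal_mul,
      Finset.sum_mul]
    refine Finset.sum_congr rfl fun k _ => by ring
  obtain ⟨U₁, hU₁, V₁, hV₁, s, hs⟩ := exists_singular_value_decomposition Z
  obtain ⟨U₂, hU₂, V₂, hV₂, t, ht⟩ := exists_singular_value_decomposition Y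
  set α : κ → Matrix (Fin n) (Fin n) ℂ := fun k => star U₁ * Matrix.diagonal (p k) * U₂ with hα
  set β : κ → Matrix (Fin n) (Fin n) ℂ := fun k => V₂ * Matrix.diagonal (q k) * star V₁ with hβ
  -- The singular values of Z are read off from the diagonal of U₁* Z V₁*, hence depend linearly on
  -- those of Y. The absolute row and column sums of the coefficients are at most c, by 2|xy| ≤ |x|²
  -- + |y|² and unitarity.
  have hst : ∀ i, s i = ∑ j, (∑ k, α k i j * β k j i) * t j := by
    intro i
    have h1 : Matrix.diagonal s = ∑ k, α k * Matrix.diagonal t * β k := by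
      calc Matrix.diagonal s = star U₁ * Z * star V₁ := by
            rw [hs]
            simp only [mul_assoc]
            rw [Matrix.mem_unitaryGroup_iff.1 hV₁, mul_one, ← mul_assoc,
              Matrix.mem_unitaryGroup_iff'.1 hU₁, one_mul]
        _ = _ := by
            rw [hZ', Finset.mul_sum, Finset.sum_mul]
            refine Finset.sum_congr rfl fun k _ => ?_
            rw [ht]
            simp only [hα, hβ, mul_assoc]
    have h2 := congrFun (congrFun h1 i) i
    rw [Matrix.diagonal_apply_eq, Matrix.sum_apply] at h2
    rw [h2]
    simp only [Matrix.mul_apply (N := β _), Matrix.mul_diagonal, Finset.sum_mul]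
    rw [Finset.sum_comm]
    refine Finset.sum_congr rfl fun j _ => Finset.sum_congr rfl fun k _ => by ring
  have hNZ : N Z = N (Matrix.diagonal s) := by
    rw [hs, hN.apply_unitary_mul_mul_unitary _ _ hU₁ _ hV₁]
  have hNY : N Y = N (Matrix.diagonal t) := by
    rw [ht, hN.apply_unitary_mul_mul_unitary _ _ hU₂ _ hV₂]
  rw [hNZ, hNY, show s = fun i => ∑ j, (∑ k, α k i j * β k j i) * t j from funext hst]
  have hU₁' := Unitary.star_mem hU₁
  have hV₁' := Unitary.star_mem hV₁
  refine hN.apply_diagonal_sum_le _ t hc (fun i => ?_) (fun j => ?_)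
  · calc _ ≤ ∑ j, (∑ k, ‖α k i j‖ ^ 2 + ∑ k, ‖β k j i‖ ^ 2) / 2 :=
          Finset.sum_le_sum fun j _ => norm_sum_mul_le_half _ _
      _ = (∑ j, ∑ k, ‖α k i j‖ ^ 2 + ∑ j, ∑ k, ‖β k j i‖ ^ 2) / 2 := by
          rw [← Finset.sum_div, Finset.sum_add_distrib]
      _ ≤ c := by
          have h1 := sum_sum_norm_sq_row_le hU₁' hU₂ p hp i
          have h2 := sum_sum_norm_sq_col_le hV₂ hV₁' q hq i
          linarith
  · calc _ ≤ ∑ i, (∑ k, ‖α k i j‖ ^ 2 + ∑ k, ‖β k j i‖ ^ 2) / 2 :=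
          Finset.sum_le_sum fun i _ => norm_sum_mul_le_half _ _
      _ = (∑ i, ∑ k, ‖α k i j‖ ^ 2 + ∑ i, ∑ k, ‖β k j i‖ ^ 2) / 2 := by
          rw [← Finset.sum_div, Finset.sum_add_distrib]
      _ ≤ c := by
          have h1 := sum_sum_norm_sq_col_le hU₁' hU₂ p hp j
          have h2 := sum_sum_norm_sq_row_le hV₂ hV₁' q hq j
          linarith

end IsUnitarilyInvariantNorm

end UnitarilyInvariant

/-! ### Functional calculus of diagonalized matrices. -/

section FunctionalCalculus

variable {ι : Type*} [Fintype ι] [DecidableEq ι]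

theorem aeval_diagonal_ofReal (x : ι → ℝ) (p : Polynomial ℝ) :
    Polynomial.aeval (Matrix.diagonal fun i => (x i : ℂ)) p =
      Matrix.diagonal fun i => ((p.eval (x i) : ℝ) : ℂ) := by
  have h := Polynomial.aeval_algHom_apply (Matrix.diagonalAlgHom (n := ι) (α := ℂ) ℝ)
    (fun i => (x i : ℂ)) p
  simp only [Matrix.diagonalAlgHom_apply] at h
  rw [h]
  congr 1
  ext i
  have h2 := Polynomial.aeval_algHom_apply (Pi.evalAlgHom ℝ (fun _ : ι => ℂ) i)
    (fun i => (x i : ℂ)) p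
  simp only [Pi.evalAlgHom_apply] at h2
  rw [← h2]
  exact Polynomial.aeval_algebraMap_apply ℂ (x i) p |>.trans (by simp)

/-- The functional calculus of a matrix in diagonalized form. -/
theorem cfc_unitary_mul_diagonal_mul_star {U : Matrix ι ι ℂ} (hU : U ∈ Matrix.unitaryGroup ι ℂ)
    (x : ι → ℝ) (f : ℝ → ℝ) :
    cfc f (U * Matrix.diagonal (fun i => (x i : ℂ)) * star U) =
      U * Matrix.diagonal (fun i => (f (x i) : ℂ)) * star U := by
  set D : Matrix ι ι ℂ := Matrix.diagonal fun i => (x i : ℂ) with hD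
  set M := U * D * star U with hM
  have hDh : D.IsHermitian := by
    rw [Matrix.IsHermitian, hD, Matrix.diagonal_conjTranspose]
    congr 1; ext i; simp
  have hMh : M.IsHermitian := by
    rw [hM, Matrix.star_eq_conjTranspose]
    exact Matrix.isHermitian_mul_mul_conjTranspose U hDh
  -- Interpolating on the union of both finite sets replaces f by a polynomial on either side,
  -- without having to identify the spectrum with the range of x.
  have hfin : ((spectrum ℝ M) ∪ Set.range x).Finite :=
    (Matrix.finite_real_spectrum (A := M)).union (Set.finite_range x)
  set p : Polynomial ℝ := Lagrange.interpolate hfin.toFinset id f with hp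
  have hpf : ∀ y ∈ (spectrum ℝ M) ∪ Set.range x, p.eval y = f y := fun y hy =>
    Lagrange.eval_interpolate_at_node (v := id) f Function.injective_id.injOn
      (hfin.mem_toFinset.2 hy)
  have h1 : cfc f M = Polynomial.aeval M p := by
    rw [← cfc_polynomial p M hMh.isSelfAdjoint]
    exact cfc_congr fun y hy => (hpf y (Or.inl hy)).symm
  have h2 : Polynomial.aeval M p = U * Polynomial.aeval D p * star U := by
    have := Polynomial.aeval_algHom_apply
      ((Unitary.conjStarAlgAut ℝ (Matrix ι ι ℂ) ⟨U, hU⟩).toStarAlgHom.toAlgHom) D p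
    exact this
  rw [h1, h2, aeval_diagonal_ofReal]
  congr 3
  ext i
  rw [hpf _ (Or.inr ⟨i, rfl⟩)]

theorem cfc_diagonal_ofReal (x : ι → ℝ) (f : ℝ → ℝ) :
    cfc f (Matrix.diagonal fun i => (x i : ℂ)) = Matrix.diagonal fun i => (f (x i) : ℂ) := by
  simpa using cfc_unitary_mul_diagonal_mul_star (one_mem (Matrix.unitaryGroup ι ℂ)) x f

theorem Matrix.IsHermitian.exists_eq_unitary_mul_diagonal_mul_star {A : Matrix ι ι ℂ}
    (hA : A.IsHermitian) : ∃ U ∈ Matrix.unitaryGroup ι ℂ,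
      A = U * Matrix.diagonal (fun i => (hA.eigenvalues i : ℂ)) * star U :=
  ⟨hA.eigenvectorUnitary, hA.eigenvectorUnitary.2, hA.spectral_theorem⟩

end FunctionalCalculus

/-! ### Operator monotonicity for matrices; first-order perturbation of a diagonal matrix. -/

section OperatorMonotone

variable {f : ℝ → ℝ}

theorem Matrix.PosDef.spectrum_subset_Ioi {ι : Type*} [Fintype ι] [DecidableEq ι]
    {A : Matrix ι ι ℂ} (hA : A.PosDef) : spectrum ℝ A ⊆ Set.Ioi 0 := by
  rw [hA.isHermitian.spectrum_real_eq_range_eigenvalues]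
  rintro _ ⟨i, rfl⟩
  exact hA.eigenvalues_pos i

/-- Matrices act on Euclidean space through a star isomorphism, which respects spectrum, order and
functional calculus. The index type lies in `Type` because the Hilbert spaces in the definition do.
-/
theorem OperatorMonotoneOn.posSemidef_cfc_sub (hf : OperatorMonotoneOn (Set.Ioi 0) f) {ι : Type}
    [Fintype ι] [DecidableEq ι] {A B : Matrix ι ι ℂ} (hA : A.PosDef) (hB : B.PosDef)
    (hAB : (B - A).PosSemidef) : (cfc f B - cfc f A).PosSemidef := by
  obtain ⟨φ, hφ⟩ : ∃ φ, φ = Matrix.toEuclideanCLM (n := ι) (𝕜 := ℂ) := ⟨_, rfl⟩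
  have hspec : ∀ M : Matrix ι ι ℂ, M.PosDef → spectrum ℝ (φ M) ⊆ Set.Ioi 0 := by
    intro M hM
    let ψ : Matrix ι ι ℂ →ₐ[ℝ] (EuclideanSpace ℂ ι →L[ℂ] EuclideanSpace ℂ ι) :=
      AlgHom.restrictScalars ℝ (AlgHomClass.toAlgHom φ)
    have h : spectrum ℝ (ψ M) ⊆ spectrum ℝ M := AlgHom.spectrum_apply_subset ψ M
    exact h.trans hM.spectrum_subset_Ioi
  have hsa : ∀ M : Matrix ι ι ℂ, M.PosDef → IsSelfAdjoint (φ M) := fun M hM =>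
    hM.isHermitian.isSelfAdjoint.map φ
  have hcfc : ∀ M : Matrix ι ι ℂ, M.PosDef → φ (cfc f M) = cfc f (φ M) := fun M hM =>
    StarAlgHomClass.map_cfc (S := ℂ) φ f M (hf.1.mono hM.spectrum_subset_Ioi)
      (LinearMap.continuous_of_finiteDimensional φ.toAlgEquiv.toLinearMap)
      hM.isHermitian.isSelfAdjoint (hsa M hM)
  have hle : ∀ M M' : Matrix ι ι ℂ, φ M ≤ φ M' ↔ (M' - M).PosSemidef := by
    intro M M'
    rw [ContinuousLinearMap.le_def, ← map_sub, ← Matrix.isPositive_toEuclideanLin_iff,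
      ← ContinuousLinearMap.isPositive_toLinearMap_iff, hφ]
    rfl
  rw [← hle, hcfc A hA, hcfc B hB]
  exact hf.2 _ (φ A) (φ B) (hsa A hA) (hsa B hB) (hspec A hA) (hspec B hB) ((hle A B).2 hAB)

theorem dslope_comm (f : ℝ → ℝ) (a b : ℝ) : dslope f a b = dslope f b a := by
  by_cases h : a = b
  · rw [h]
  · rw [dslope_of_ne _ h, dslope_of_ne _ (Ne.symm h), slope_comm]

/-- The Leibniz rule for divided differences: the same recursion governs the entries of the
derivative of M q(M) in the direction of the all-ones matrix. -/
theorem dslope_eval_X_mul (q : Polynomial ℝ) (a b : ℝ) :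
    dslope (fun y => (q * Polynomial.X).eval y) a b =
      a * dslope (fun y => q.eval y) a b + q.eval b := by
  by_cases h : b = a
  · subst h
    simp only [dslope_same, Polynomial.deriv]
    simp
    ring
  · have : b - a ≠ 0 := sub_ne_zero.2 h
    rw [dslope_of_ne _ h, dslope_of_ne _ h, slope_def_field, slope_def_field]
    simp only [Polynomial.eval_mul, Polynomial.eval_X]
    field_simp
    ring

variable {ι : Type*} [Fintype ι] [DecidableEq ι]

/-- The derivative of a polynomial at a diagonal matrix in the direction of the all-ones matrix
is the Loewner matrix. -/
theorem hasDerivAt_aeval_diagonal_add_smul (x : ι → ℝ) (p : Polynomial ℝ) (i j : ι) :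
    HasDerivAt (fun t : ℝ => (Polynomial.aeval (Matrix.diagonal (fun i => (x i : ℂ)) +
        (t : ℂ) • (Matrix.of fun _ _ => 1 : Matrix ι ι ℂ)) p) i j)
      ((dslope (fun y => p.eval y) (x i) (x j) : ℝ) : ℂ) 0 := by
  induction p using Polynomial.induction_on generalizing i j with
  | C a =>
    have : dslope (fun _ : ℝ => a) (x i) (x j) = 0 := by
      by_cases h : x j = x i
      · rw [h, dslope_same]; simp
      · rw [dslope_of_ne _ h, slope_def_field]; simp
    simp only [Polynomial.aeval_C, Polynomial.eval_C, this, Complex.ofReal_zero]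
    exact hasDerivAt_const _ _
  | add p q hp hq =>
    have : dslope (fun y => (p + q).eval y) (x i) (x j) =
        dslope (fun y => p.eval y) (x i) (x j) + dslope (fun y => q.eval y) (x i) (x j) := by
      by_cases h : x j = x i
      · simp only [h, dslope_same, Polynomial.deriv]; simp
      · simp only [dslope_of_ne _ h, slope_def_field, Polynomial.eval_add]; ring
    simp only [map_add, Matrix.add_apply, this, Complex.ofReal_add]
    exact (hp i j).add (hq i j)
  | monomial k a ih =>
    set q : Polynomial ℝ := Polynomial.C a * Polynomial.X ^ k with hq
    rw [pow_succ, ← mul_assoc, ← hq, mul_comm]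
    rw [mul_comm Polynomial.X q, dslope_eval_X_mul, mul_comm q]
    simp only [map_mul, Polynomial.aeval_X, Matrix.mul_apply]
    have hM : ∀ k, HasDerivAt (fun t : ℝ => (Matrix.diagonal (fun i => (x i : ℂ)) +
        (t : ℂ) • (Matrix.of fun _ _ => 1 : Matrix ι ι ℂ)) i k) 1 0 := by
      intro k
      simpa using (Complex.ofRealCLM.hasDerivAt (x := 0)).const_add
        ((Matrix.diagonal (fun i => (x i : ℂ)) : Matrix ι ι ℂ) i k)
    have := HasDerivAt.fun_sum (u := Finset.univ) fun k _ => (hM k).mul (ih k j)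
    refine this.congr_deriv ?_
    simp only [Complex.ofReal_zero, zero_smul, add_zero, aeval_diagonal_ofReal]
    rw [Finset.sum_add_distrib]
    simp [Matrix.diagonal_apply, Finset.sum_ite_eq, add_comm]

/-- Hermite interpolation to first order. -/
theorem exists_polynomial_eval_eq_deriv_eq (x : ι → ℝ) (hx : Function.Injective x) (a b : ι → ℝ) :
    ∃ p : Polynomial ℝ, ∀ i, p.eval (x i) = a i ∧ p.derivative.eval (x i) = b i := by
  set p₀ := Lagrange.interpolate Finset.univ x a with hp₀
  set w := Lagrange.nodal Finset.univ x with hw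
  have hwd : ∀ i, w.derivative.eval (x i) ≠ 0 := by
    intro i h
    have h1 := Lagrange.nodalWeight_eq_eval_derivative_nodal (v := x) (Finset.mem_univ i)
    rw [← hw, h, inv_zero] at h1
    exact Lagrange.nodalWeight_ne_zero hx.injOn (Finset.mem_univ i) h1
  have hw0 : ∀ i, w.eval (x i) = 0 := fun i => Lagrange.eval_nodal_at_node (Finset.mem_univ i)
  set q := Lagrange.interpolate Finset.univ x
    fun i => (b i - p₀.derivative.eval (x i)) / w.derivative.eval (x i) with hq
  -- As w vanishes at the nodes, adding w q keeps the values and changes the derivative at x i by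
  -- w'(x i) q(x i), where w'(x i) ≠ 0.
  refine ⟨p₀ + w * q, fun i => ⟨?_, ?_⟩⟩
  · simp only [Polynomial.eval_add, Polynomial.eval_mul, hw0, zero_mul, add_zero]
    exact Lagrange.eval_interpolate_at_node a hx.injOn (Finset.mem_univ i)
  · simp only [Polynomial.derivative_add, Polynomial.derivative_mul, Polynomial.eval_add,
      Polynomial.eval_mul, hw0, zero_mul, add_zero]
    rw [hq, Lagrange.eval_interpolate_at_node _ hx.injOn (Finset.mem_univ i), mul_div_cancel₀ _ (hwd i)]
    ring

open scoped Matrix.Norms.L2Operator in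
-- A Bauer–Fike argument: if μ were at distance at least r from every x i, then v = (μ − D)⁻¹ E v
-- with ‖(μ − D)⁻¹ E‖ < 1, so v = 0.
theorem exists_abs_sub_lt_of_eigenvector (x : ι → ℝ) {E : Matrix ι ι ℂ} {r μ : ℝ} (hE : ‖E‖ < r)
    {v : ι → ℂ} (hv : v ≠ 0)
    (h : ((Matrix.diagonal fun i => (x i : ℂ)) + E).mulVec v = (μ : ℂ) • v) :
    ∃ i, |μ - x i| < r := by
  by_contra! hcon
  have hr : 0 < r := (norm_nonneg _).trans_lt hE
  have hne : ∀ i, ((μ : ℂ) - x i) ≠ 0 := by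
    intro i h0
    have : μ - x i = 0 := by exact_mod_cast h0
    have := hcon i
    simp_all
    linarith
  set G : Matrix ι ι ℂ := Matrix.diagonal fun i => ((μ : ℂ) - x i)⁻¹ with hG
  have hGn : ‖G‖ ≤ r⁻¹ := by
    rw [hG, Matrix.l2_opNorm_diagonal, pi_norm_le_iff_of_nonneg (by positivity)]
    intro i
    rw [norm_inv, ← Complex.ofReal_sub, Complex.norm_real]
    exact inv_anti₀ hr (hcon i)
  have hGv : (G * E).mulVec v = v := by
    have h1 : E.mulVec v = fun i => ((μ : ℂ) - x i) * v i := by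
      ext i
      have := congrFun h i
      simp only [Matrix.add_mulVec, Pi.add_apply, Matrix.mulVec_diagonal, Pi.smul_apply,
        smul_eq_mul] at this
      linear_combination this
    rw [← Matrix.mulVec_mulVec, h1, hG]
    ext i
    rw [Matrix.mulVec_diagonal, inv_mul_cancel_left₀ (hne i)]
  have h2 := Matrix.l2_opNorm_mulVec (G * E) (WithLp.toLp 2 v)
  have h3 : ‖G * E‖ < 1 := by
    calc ‖G * E‖ ≤ ‖G‖ * ‖E‖ := norm_mul_le _ _
      _ ≤ r⁻¹ * ‖E‖ := by gcongr
      _ < r⁻¹ * r := by gcongr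
      _ = 1 := inv_mul_cancel₀ hr.ne'
  have h4 : 0 < ‖(WithLp.toLp 2 v : EuclideanSpace ℂ ι)‖ := by
    rw [norm_pos_iff]
    intro h
    exact hv (by simpa using h)
  rw [hGv] at h2
  change ‖(WithLp.toLp 2 v : EuclideanSpace ℂ ι)‖ ≤ _ at h2
  nlinarith

open scoped Matrix.Norms.L2Operator in
theorem abs_re_dotProduct_mulVec_le (H : Matrix ι ι ℂ) (w : ι → ℂ) :
    |(dotProduct (star w) (H.mulVec w)).re| ≤
      ‖H‖ * ‖(WithLp.toLp 2 w : EuclideanSpace ℂ ι)‖ ^ 2 := by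
  have h1 : dotProduct (star w) (H.mulVec w) =
      inner ℂ (WithLp.toLp 2 w : EuclideanSpace ℂ ι) (WithLp.toLp 2 (H.mulVec w)) := by
    rw [EuclideanSpace.inner_toLp_toLp, dotProduct_comm]
  rw [h1]
  refine (Complex.abs_re_le_norm _).trans ((norm_inner_le_norm _ _).trans ?_)
  have := Matrix.l2_opNorm_mulVec H (WithLp.toLp 2 w)
  calc _ ≤ ‖(WithLp.toLp 2 w : EuclideanSpace ℂ ι)‖ *
        (‖H‖ * ‖(WithLp.toLp 2 w : EuclideanSpace ℂ ι)‖) := by gcongr; exact this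
    _ = _ := by ring

open scoped Matrix.Norms.L2Operator in
-- Eigenvalues of the perturbed matrix stay within r of the nodes, so only the size of h there
-- matters. This controls the remainder of f after interpolation, with no regularity of f beyond
-- differentiability at the nodes.
theorem norm_cfc_diagonal_add_le (x : ι → ℝ) {E : Matrix ι ι ℂ} (hE : E.IsHermitian) {r c : ℝ}
    (hr : ‖E‖ < r) (hc : 0 ≤ c) (h : ℝ → ℝ) (hh : ∀ i, ∀ y, |y - x i| < r → |h y| ≤ c) :
    ‖cfc h ((Matrix.diagonal fun i => (x i : ℂ)) + E)‖ ≤ c := by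
  have hDh : (Matrix.diagonal fun i => (x i : ℂ) : Matrix ι ι ℂ).IsHermitian := by
    rw [Matrix.IsHermitian, Matrix.diagonal_conjTranspose]
    congr 1; ext i; simp
  have hM := hDh.add hE
  set M := (Matrix.diagonal fun i => (x i : ℂ)) + E with hMdef
  obtain ⟨U, hU, hUM⟩ := hM.exists_eq_unitary_mul_diagonal_mul_star
  have h1 := cfc_unitary_mul_diagonal_mul_star hU hM.eigenvalues h
  rw [← hUM] at h1
  rw [h1, CStarRing.norm_mul_mem_unitary _ (Unitary.star_mem hU),
    CStarRing.norm_mem_unitary_mul _ hU, Matrix.l2_opNorm_diagonal, pi_norm_le_iff_of_nonneg hc]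
  intro k
  rw [Complex.norm_real]
  obtain ⟨i, hi⟩ := exists_abs_sub_lt_of_eigenvector x hr (μ := hM.eigenvalues k)
    (v := (hM.eigenvectorBasis k : ι → ℂ)) (by
      intro h0
      have := hM.eigenvectorBasis.orthonormal.1 k
      have h2 : hM.eigenvectorBasis k = 0 := by ext j; exact congrFun h0 j
      simp [h2] at this) (by
      rw [← hMdef, hM.mulVec_eigenvectorBasis k]
      rfl)
  exact hh i _ hi

end OperatorMonotone

/-! ### Positivity of the Loewner matrix. -/

section Loewner

open Filter Topology

variable {f : ℝ → ℝ}

theorem posDef_diagonal_ofReal {ι : Type*} [Fintype ι] [DecidableEq ι] {x : ι → ℝ}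
    (hx : ∀ i, 0 < x i) : (Matrix.diagonal fun i => (x i : ℂ) : Matrix ι ι ℂ).PosDef :=
  Matrix.PosDef.diagonal fun i => by simpa using hx i

open scoped Matrix.Norms.L2Operator in
-- Let p agree with f to first order at the nodes, which must be distinct for this. The difference
-- quotient of p(D + tJ) tends to the Loewner matrix, the remainder (f − p)(D + tJ) is o(t), and f(D
-- + tJ) − f(D) ≥ 0 for t > 0. Differentiability at the nodes is a hypothesis because its proof
-- relies on this lemma.
theorem OperatorMonotoneOn.posSemidef_dslope_of_injective (hf : OperatorMonotoneOn (Set.Ioi 0) f)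
    {ι : Type} [Fintype ι] [DecidableEq ι] {x : ι → ℝ} (hinj : Function.Injective x)
    (hx : ∀ i, 0 < x i) (hd : ∀ i, DifferentiableAt ℝ f (x i)) :
    (Matrix.of fun i j => ((dslope f (x i) (x j) : ℝ) : ℂ) : Matrix ι ι ℂ).PosSemidef := by
  set L : Matrix ι ι ℂ := Matrix.of fun i j => ((dslope f (x i) (x j) : ℝ) : ℂ) with hL
  have hLh : L.IsHermitian := by
    ext i j
    simp [hL, dslope_comm f (x i) (x j)]
  set J : Matrix ι ι ℂ := Matrix.of fun _ _ => 1 with hJ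
  have hJp : J.PosSemidef := by
    convert Matrix.posSemidef_vecMulVec_self_star (fun _ : ι => (1 : ℂ)) using 1
    ext i j
    simp [hJ, Matrix.vecMulVec_apply]
  set D : Matrix ι ι ℂ := Matrix.diagonal fun i => (x i : ℂ) with hD
  have hDp : D.PosDef := posDef_diagonal_ofReal hx
  rw [Matrix.posSemidef_iff_dotProduct_mulVec]
  refine ⟨hLh, fun w => ?_⟩
  rw [RCLike.nonneg_iff]
  refine ⟨?_, hLh.im_star_dotProduct_mulVec_self w⟩
  change 0 ≤ (dotProduct (star w) (L.mulVec w)).re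
  set Q : Matrix ι ι ℂ → ℝ := fun M => (dotProduct (star w) (M.mulVec w)).re with hQ
  have hQadd : ∀ M M', Q (M + M') = Q M + Q M' := fun M M' => by
    simp [hQ, Matrix.add_mulVec, dotProduct_add]
  have hQsub : ∀ M M', Q (M - M') = Q M - Q M' := fun M M' => by
    simp [hQ, Matrix.sub_mulVec, dotProduct_sub]
  obtain ⟨p, hp⟩ := exists_polynomial_eval_eq_deriv_eq x hinj (fun i => f (x i))
    (fun i => deriv f (x i))
  have hpL : ∀ i j, dslope (fun y => p.eval y) (x i) (x j) = dslope f (x i) (x j) := by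
    intro i j
    by_cases h : x j = x i
    · rw [h, dslope_same, dslope_same, Polynomial.deriv, (hp i).2]
    · rw [dslope_of_ne _ h, dslope_of_ne _ h, slope_def_field, slope_def_field, (hp i).1, (hp j).1]
  set h : ℝ → ℝ := fun y => f y - p.eval y with hh
  have hh0 : ∀ i, h (x i) = 0 := fun i => sub_eq_zero.2 (hp i).1.symm
  have hhd : ∀ i, HasDerivAt h 0 (x i) := fun i => by
    have := (hd i).hasDerivAt.sub (p.hasDerivAt (x i))
    rwa [(hp i).2, sub_self] at this
  have hM : ∀ t : ℝ, 0 ≤ t → (D + (t : ℂ) • J).PosDef ∧ ((t : ℂ) • J).PosSemidef := by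
    intro t ht
    have h1 : ((t : ℂ) • J).PosSemidef := hJp.smul (by simpa using ht)
    exact ⟨hDp.add_posSemidef h1, h1⟩
  have hsplit : ∀ M : Matrix ι ι ℂ, M.IsHermitian → cfc f M = Polynomial.aeval M p + cfc h M := by
    intro M hMh
    have : ∀ g : ℝ → ℝ, ContinuousOn g (spectrum ℝ M) := fun g =>
      (Matrix.finite_real_spectrum (A := M)).continuousOn g
    rw [← cfc_polynomial p M hMh.isSelfAdjoint, ← cfc_add _ _ _ (this _) (this _)]
    refine cfc_congr fun y _ => ?_
    simp [hh]
  have hcD : cfc h D = 0 := by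
    rw [hD, cfc_diagonal_ofReal]
    simp [hh0]
  set φ : ℝ → ℝ := fun t => Q (Polynomial.aeval (D + (t : ℂ) • J) p) with hφ
  have hφ0 : φ 0 = Q (Polynomial.aeval D p) := by simp [hφ]
  have hφd : HasDerivAt φ (Q L) 0 := by
    have h1 : ∀ M : Matrix ι ι ℂ, Q M = (∑ i, star (w i) * ∑ j, M i j * w j).re := fun M => rfl
    simp only [hφ, h1]
    have h2 := HasDerivAt.fun_sum (u := Finset.univ) fun i _ => (HasDerivAt.fun_sum
      (u := Finset.univ) fun j _ =>
        (hasDerivAt_aeval_diagonal_add_smul x p i j).mul_const (w j)).const_mul (star (w i))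
    have h3 := (Complex.reCLM.hasFDerivAt).comp_hasDerivAt (0 : ℝ) h2
    refine h3.congr_deriv ?_
    simp [hL, hpL]
  -- The extra 1 makes ‖tJ‖ < t(‖J‖ + 1) strict, as the perturbation bound requires.
  set K : ℝ := (‖J‖ + 1) * ‖(WithLp.toLp 2 w : EuclideanSpace ℂ ι)‖ ^ 2 with hK
  have hK0 : 0 ≤ K := by positivity
  have key : ∀ ε : ℝ, 0 < ε → -(ε * K) ≤ Q L := by
    intro ε hε
    have hev : ∀ i, ∀ᶠ r in 𝓝[>] (0 : ℝ), ∀ y, |y - x i| < r → |h y| ≤ ε * r := by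
      intro i
      have h1 := (hhd i).isLittleO.bound hε
      obtain ⟨δ, hδ, h2⟩ := Metric.eventually_nhds_iff.1 h1
      filter_upwards [Ioo_mem_nhdsGT hδ] with r hr y hy
      have h3 := h2 (y := y) (by rw [Real.dist_eq]; exact hy.trans hr.2)
      simp only [hh0, smul_zero, sub_zero, Real.norm_eq_abs] at h3
      exact h3.trans (by gcongr)
    have hev' : ∀ᶠ r in 𝓝[>] (0 : ℝ), ∀ i, ∀ y, |y - x i| < r → |h y| ≤ ε * r :=
      eventually_all.2 hev
    have htend : Tendsto (fun t : ℝ => t * (‖J‖ + 1)) (𝓝[>] 0) (𝓝[>] 0) := by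
      rw [tendsto_nhdsWithin_iff]
      constructor
      · have : Tendsto (fun t : ℝ => t * (‖J‖ + 1)) (𝓝 0) (𝓝 (0 * (‖J‖ + 1))) :=
          (continuous_id.mul continuous_const).tendsto 0
        rw [zero_mul] at this
        exact this.mono_left nhdsWithin_le_nhds
      · filter_upwards [self_mem_nhdsWithin] with t ht
        have : (0 : ℝ) < t := ht
        exact mul_pos this (by positivity)
    have hslope : Tendsto (slope φ 0) (𝓝[>] 0) (𝓝 (Q L)) :=
      (hasDerivWithinAt_iff_tendsto_slope' (Set.self_notMem_Ioi)).1 hφd.hasDerivWithinAt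
    refine ge_of_tendsto hslope ?_
    filter_upwards [htend.eventually hev', self_mem_nhdsWithin] with t ht ht0
    have ht0' : 0 < t := ht0
    obtain ⟨hMp, hJt⟩ := hM t ht0'.le
    have h1 := (hf.posSemidef_cfc_sub hDp hMp (by simpa using hJt)).re_dotProduct_nonneg w
    have h1' : 0 ≤ Q (cfc f (D + (t : ℂ) • J) - cfc f D) := h1
    rw [hQsub, hsplit _ hMp.isHermitian, hsplit _ hDp.isHermitian, hcD, add_zero, hQadd,
      ← hφ0] at h1'
    have hnorm : ‖(t : ℂ) • J‖ < t * (‖J‖ + 1) := by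
      rw [norm_smul, Complex.norm_real, Real.norm_of_nonneg ht0'.le]
      gcongr
      linarith
    have h2 := norm_cfc_diagonal_add_le x hJt.isHermitian hnorm (c := ε * (t * (‖J‖ + 1)))
      (by positivity) h ht
    have h3 := abs_re_dotProduct_mulVec_le (cfc h (D + (t : ℂ) • J)) w
    have h4 : Q (cfc h (D + (t : ℂ) • J)) ≤ ε * K * t := by
      refine (le_abs_self _).trans (h3.trans ?_)
      calc _ ≤ ε * (t * (‖J‖ + 1)) * ‖(WithLp.toLp 2 w : EuclideanSpace ℂ ι)‖ ^ 2 := by gcongr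
        _ = _ := by rw [hK]; ring
    rw [slope_def_field, sub_zero, le_div_iff₀ ht0']
    change 0 ≤ φ t + _ - _ at h1'
    linarith
  by_contra! hneg
  rcases hK0.eq_or_lt with hK1 | hK1
  · have := key 1 one_pos
    rw [← hK1] at this
    linarith
  · have := key (-Q L / (2 * K)) (div_pos (neg_pos.2 hneg) (by positivity))
    have h5 : -Q L / (2 * K) * K = -Q L / 2 := by field_simp
    have h6 : Q L < 0 := hneg
    linarith

/-- The Loewner matrix of an operator monotone function is positive semidefinite. -/
theorem OperatorMonotoneOn.posSemidef_dslope (hf : OperatorMonotoneOn (Set.Ioi 0) f)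
    {ι : Type} [Fintype ι] {x : ι → ℝ} (hx : ∀ i, 0 < x i)
    (hd : ∀ i, DifferentiableAt ℝ f (x i)) :
    (Matrix.of fun i j => ((dslope f (x i) (x j) : ℝ) : ℂ) : Matrix ι ι ℂ).PosSemidef := by
  classical
  -- Nodes may coincide, for instance when A and B share an eigenvalue; the matrix is then a
  -- submatrix, with repeated indices, of the one for the distinct values.
  let T := Finset.univ.image x
  have hT : ∀ y : T, ∃ i, x i = y := fun y => by
    obtain ⟨i, -, hi⟩ := Finset.mem_image.1 y.2
    exact ⟨i, hi⟩
  have h := hf.posSemidef_dslope_of_injective (x := fun y : T => (y : ℝ)) Subtype.val_injective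
    (fun y => by obtain ⟨i, hi⟩ := hT y; exact hi ▸ hx i)
    (fun y => by obtain ⟨i, hi⟩ := hT y; exact hi ▸ hd i)
  exact h.submatrix fun i => (⟨x i, Finset.mem_image_of_mem x (Finset.mem_univ i)⟩ : T)

/-! ### Monotonicity, concavity and differentiability of operator monotone functions. -/

theorem OperatorMonotoneOn.monotoneOn (hf : OperatorMonotoneOn (Set.Ioi 0) f) :
    MonotoneOn f (Set.Ioi 0) := by
  intro a ha b hb hab
  have h := hf.posSemidef_cfc_sub (posDef_diagonal_ofReal (x := fun _ : Unit => a) fun _ => ha)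
    (posDef_diagonal_ofReal (x := fun _ : Unit => b) fun _ => hb) (by
      rw [Matrix.diagonal_sub]
      exact Matrix.PosSemidef.diagonal fun _ => by simpa using hab)
  rw [cfc_diagonal_ofReal, cfc_diagonal_ofReal] at h
  have := h.diag_nonneg (i := ())
  simpa using this

/-- Concavity up to ε. Rotating diag(a, b) gives a matrix M whose corner is the convex combination;
a diagonal matrix above M exceeds that corner by only ε, and the corners of f are compared. -/
theorem OperatorMonotoneOn.le_apply_add (hf : OperatorMonotoneOn (Set.Ioi 0) f) {a b : ℝ}
    (ha : 0 < a) (hb : 0 < b) {u v : ℝ} (huv : u ^ 2 + v ^ 2 = 1) {ε : ℝ} (hε : 0 < ε) :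
    u ^ 2 * f a + v ^ 2 * f b ≤ f (u ^ 2 * a + v ^ 2 * b + ε) := by
  set V : Matrix (Fin 2) (Fin 2) ℂ := !![(u : ℂ), v; -v, u] with hV
  have huv' : (u : ℂ) ^ 2 + (v : ℂ) ^ 2 = 1 := by exact_mod_cast huv
  have hVu : V ∈ Matrix.unitaryGroup (Fin 2) ℂ := by
    rw [Matrix.mem_unitaryGroup_iff, Matrix.star_eq_conjTranspose]
    ext i j
    fin_cases i <;> fin_cases j <;> simp [hV, Matrix.mul_apply, Fin.sum_univ_two]
    · linear_combination huv'
    · ring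
    · ring
    · linear_combination huv'
  have hVD : ∀ z : Fin 2 → ℝ, V * Matrix.diagonal (fun i => (z i : ℂ)) * star V =
      !![(u : ℂ) ^ 2 * z 0 + (v : ℂ) ^ 2 * z 1, u * v * (z 1 - z 0);
        u * v * (z 1 - z 0), (v : ℂ) ^ 2 * z 0 + (u : ℂ) ^ 2 * z 1] := by
    intro z
    ext i j
    rw [Matrix.mul_apply, Fin.sum_univ_two, Matrix.mul_diagonal, Matrix.mul_diagonal]
    fin_cases i <;> fin_cases j <;> simp [hV, Matrix.star_apply] <;> ring
  set x : Fin 2 → ℝ := ![a, b] with hx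
  have hx0 : ∀ i, 0 < x i := by intro i; fin_cases i <;> simpa [hx]
  set d := u * v * (b - a) with hd
  set m := u ^ 2 * a + v ^ 2 * b with hm
  set m' := v ^ 2 * a + u ^ 2 * b with hm'
  have hm0 : 0 ≤ m := by positivity
  have hm0' : 0 ≤ m' := by positivity
  -- Room ε in the first entry costs d²/ε in the second: the difference from M is ε⁻¹ (ε, −d)(ε,
  -- −d)* plus diag(0, 1). The summand 1 makes positivity of the entry immediate.
  set y : Fin 2 → ℝ := ![m + ε, m' + d ^ 2 / ε + 1] with hy
  have hy0 : ∀ i, 0 < y i := by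
    intro i
    fin_cases i
    · simp only [hy, Fin.zero_eta, Matrix.cons_val_zero]; positivity
    · simp only [hy, Fin.mk_one, Matrix.cons_val_one, Matrix.cons_val_zero]; positivity
  set M := V * Matrix.diagonal (fun i => (x i : ℂ)) * star V with hM
  have hMp : M.PosDef := by
    have h1 : Function.Injective V.vecMul := by
      rw [Matrix.vecMul_injective_iff_isUnit]
      exact IsUnit.of_mul_eq_one _ (Matrix.mem_unitaryGroup_iff.1 hVu)
    exact (posDef_diagonal_ofReal hx0).mul_mul_conjTranspose_same h1
  have hle : (Matrix.diagonal (fun i => (y i : ℂ)) - M).PosSemidef := by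
    have hp1 : (((ε⁻¹ : ℝ) : ℂ) • Matrix.vecMulVec ![(ε : ℂ), -d] (star ![(ε : ℂ), -d])).PosSemidef :=
      (Matrix.posSemidef_vecMulVec_self_star _).smul (by simpa using hε.le)
    have hp2 : (Matrix.diagonal ![(0 : ℂ), 1]).PosSemidef :=
      Matrix.PosSemidef.diagonal fun i => by fin_cases i <;> simp
    convert hp1.add hp2 using 1
    have hε' : (ε : ℂ) ≠ 0 := by exact_mod_cast hε.ne'
    rw [hM, hVD]
    ext i j
    rw [Matrix.add_apply, Matrix.smul_apply, Matrix.vecMulVec_apply]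
    fin_cases i <;> fin_cases j <;> simp [hx, hy, hd, hm, hm'] <;> field_simp <;> ring
  have h := hf.posSemidef_cfc_sub hMp (posDef_diagonal_ofReal hy0) hle
  rw [hM, cfc_unitary_mul_diagonal_mul_star hVu, cfc_diagonal_ofReal,
    hVD fun i => f (x i)] at h
  have h00 := h.diag_nonneg (i := 0)
  simp only [hx, hy, Matrix.sub_apply, Matrix.diagonal_apply_eq, Matrix.of_apply,
    Matrix.cons_val_zero, Matrix.cons_val_one] at h00
  exact sub_nonneg.1 (by exact_mod_cast h00)

theorem OperatorMonotoneOn.concaveOn (hf : OperatorMonotoneOn (Set.Ioi 0) f) :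
    ConcaveOn ℝ (Set.Ioi 0) f := by
  refine ⟨convex_Ioi 0, fun a ha b hb u v hu hv huv => ?_⟩
  have hm : 0 < u * a + v * b := (convex_Ioi (0 : ℝ)) ha hb hu hv huv
  simp only [smul_eq_mul]
  have hcont : Tendsto (fun ε => f (u * a + v * b + ε)) (𝓝[>] 0) (𝓝 (f (u * a + v * b))) := by
    have h1 : ContinuousAt f (u * a + v * b) := hf.1.continuousAt (Ioi_mem_nhds hm)
    have h2 : Tendsto (fun ε : ℝ => u * a + v * b + ε) (𝓝 0) (𝓝 (u * a + v * b)) := by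
      simpa using (continuous_const.add continuous_id).tendsto (X := ℝ) (0 : ℝ)
        (f := fun ε => u * a + v * b + ε)
    exact h1.tendsto.comp (h2.mono_left nhdsWithin_le_nhds)
  refine ge_of_tendsto hcont ?_
  filter_upwards [self_mem_nhdsWithin] with ε hε
  have := hf.le_apply_add ha hb (u := √u) (v := √v)
    (by rw [Real.sq_sqrt hu, Real.sq_sqrt hv, huv]) (ε := ε) hε
  simpa only [Real.sq_sqrt hu, Real.sq_sqrt hv] using this

theorem OperatorMonotoneOn.deriv_nonneg_of_differentiableAt
    (hf : OperatorMonotoneOn (Set.Ioi 0) f) {x : ℝ} (hx : 0 < x) (hdx : DifferentiableAt ℝ f x) :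
    0 ≤ deriv f x := by
  have := (hf.posSemidef_dslope (x := fun _ : Unit => x) (fun _ => hx) fun _ => hdx).diag_nonneg
    (i := ())
  simpa using this

theorem OperatorMonotoneOn.sq_slope_le_deriv_mul_deriv (hf : OperatorMonotoneOn (Set.Ioi 0) f)
    {x y : ℝ} (hx : 0 < x) (hxy : x < y) (hdx : DifferentiableAt ℝ f x)
    (hdy : DifferentiableAt ℝ f y) : slope f x y ^ 2 ≤ deriv f x * deriv f y := by
  have h := hf.posSemidef_dslope (x := ![x, y])
    (fun i => by fin_cases i <;> simp [hx, hx.trans hxy])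
    (fun i => by fin_cases i <;> simp [hdx, hdy])
  have h1 := h.det_nonneg
  rw [Matrix.det_fin_two] at h1
  simp only [Matrix.of_apply, Matrix.cons_val_zero, Matrix.cons_val_one, dslope_same] at h1
  rw [dslope_comm f y x, dslope_of_ne _ hxy.ne'] at h1
  have h2 : 0 ≤ deriv f x * deriv f y - slope f x y * slope f x y := by exact_mod_cast h1
  linarith [sq (slope f x y)]

/-- A form of the two-point Loewner inequality that does not refer to derivatives. -/
theorem OperatorMonotoneOn.sq_slope_le_slope_mul_slope (hf : OperatorMonotoneOn (Set.Ioi 0) f)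
    {z x w y : ℝ} (hz : 0 < z) (hzx : z < x) (hxw : x < w) (hwy : w < y) :
    slope f x y ^ 2 ≤ slope f z x * slope f w y := by
  -- By Lebesgue's theorem the monotone f is differentiable almost everywhere. At such points the 2
  -- × 2 determinant inequality holds, and concavity bounds each derivative by a slope to its left;
  -- continuity then reaches all points.
  have hdense : Dense {t : ℝ | 0 < t → DifferentiableAt ℝ f t} := by
    refine MeasureTheory.Measure.dense_of_ae (μ := MeasureTheory.volume) ?_
    filter_upwards [hf.monotoneOn.ae_differentiableWithinAt_of_mem] with t ht h0
    exact (ht h0).differentiableAt (Ioi_mem_nhds h0)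
  set S : Set ℝ := {t : ℝ | 0 < t → DifferentiableAt ℝ f t} with hS
  have hne : ∀ t, (𝓝[S] t).NeBot := fun t => mem_closure_iff_nhdsWithin_neBot.1 (hdense t)
  have hcont : ∀ t, 0 < t → Tendsto f (𝓝[S] t) (𝓝 (f t)) := fun t ht =>
    (hf.1.continuousAt (Ioi_mem_nhds ht)).tendsto.mono_left nhdsWithin_le_nhds
  have hid : ∀ t, Tendsto (fun s : ℝ => s) (𝓝[S] t) (𝓝 t) := fun t => nhdsWithin_le_nhds
  have hslope1 : ∀ a t, 0 < t → a ≠ t → Tendsto (fun s => slope f a s) (𝓝[S] t)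
      (𝓝 (slope f a t)) := by
    intro a t ht hat
    simp only [slope_def_field]
    exact ((hcont t ht).sub_const _).div ((hid t).sub_const _) (sub_ne_zero.2 hat.symm)
  have hx0 : 0 < x := hz.trans hzx
  have hw0 : 0 < w := hx0.trans hxw
  have hy0 : 0 < y := hw0.trans hwy
  have hnn : ∀ a b, 0 < a → a < b → 0 ≤ slope f a b := fun a b ha hab =>
    hf.monotoneOn.slope_nonneg ha (ha.trans hab)
  have step : ∀ x ∈ S, z < x → x < w → slope f x y ^ 2 ≤ slope f z x * slope f w y := by
    intro x hxS hzx hxw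
    have hx0 : 0 < x := hz.trans hzx
    have := hne y
    refine le_of_tendsto_of_tendsto ((hslope1 x y hy0 (hxw.trans hwy).ne).pow 2)
      ((hslope1 w y hy0 hwy.ne).const_mul (slope f z x)) ?_
    filter_upwards [self_mem_nhdsWithin, nhdsWithin_le_nhds (Ioi_mem_nhds hwy)] with s hsS hs
    have hws : w < s := hs
    have hs0 : 0 < s := hw0.trans hws
    refine (hf.sq_slope_le_deriv_mul_deriv hx0 (hxw.trans hws) (hxS hx0) (hsS hs0)).trans ?_
    exact mul_le_mul (hf.concaveOn.deriv_le_slope hz hx0 hzx (hxS hx0))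
      (hf.concaveOn.deriv_le_slope hw0 hs0 hws (hsS hs0))
      (hf.deriv_nonneg_of_differentiableAt hs0 (hsS hs0)) (hnn z x hz hzx)
  have := hne x
  have hsl : Tendsto (fun s => slope f s y) (𝓝[S] x) (𝓝 (slope f x y)) := by
    simp only [slope_comm f _ y]
    exact hslope1 y x hx0 (hxw.trans hwy).ne'
  refine le_of_tendsto_of_tendsto (hsl.pow 2)
    ((hslope1 z x hx0 hzx.ne).mul_const (slope f w y)) ?_
  filter_upwards [self_mem_nhdsWithin, nhdsWithin_le_nhds (Ioi_mem_nhds hzx),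
    nhdsWithin_le_nhds (Iio_mem_nhds hxw)] with s hsS hzs hsw
  exact step s hsS hzs hsw

/-- Concavity gives one-sided derivatives a (right) and b (left) with 0 ≤ a ≤ b. In the
derivative-free inequality, letting the points tend to x one after another gives b² ≤ ba, which
forces a = b. -/
theorem OperatorMonotoneOn.differentiableAt (hf : OperatorMonotoneOn (Set.Ioi 0) f) {x : ℝ}
    (hx : 0 < x) : DifferentiableAt ℝ f x := by
  have hint : x ∈ interior (Set.Ioi (0 : ℝ)) := by rwa [interior_Ioi]
  have hconv := hf.concaveOn.neg
  obtain ⟨a, ha⟩ : ∃ a, HasDerivWithinAt f a (Set.Ioi x) x := by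
    have := (hconv.hasDerivWithinAt_rightDeriv_of_mem_interior hint).neg
    rw [neg_neg] at this
    exact ⟨_, this⟩
  obtain ⟨b, hb⟩ : ∃ b, HasDerivWithinAt f b (Set.Iio x) x := by
    have := (hconv.hasDerivWithinAt_leftDeriv_of_mem_interior hint).neg
    rw [neg_neg] at this
    exact ⟨_, this⟩
  have ha' := (hasDerivWithinAt_iff_tendsto_slope' Set.self_notMem_Ioi).1 ha
  have hb' := (hasDerivWithinAt_iff_tendsto_slope' Set.self_notMem_Iio).1 hb
  have hcont : ContinuousAt f x := hf.1.continuousAt (Ioi_mem_nhds hx)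
  have hcs : ∀ c, c ≠ x → Tendsto (fun s => slope f c s) (𝓝 x) (𝓝 (slope f c x)) := by
    intro c hc
    simp only [slope_def_field]
    exact (hcont.tendsto.sub_const _).div (tendsto_id.sub_const _) (sub_ne_zero.2 hc.symm)
  have hpos : ∀ᶠ s in 𝓝[<] x, 0 < s := nhdsWithin_le_nhds (Ioi_mem_nhds hx)
  have hlt : ∀ᶠ s in 𝓝[<] x, s < x := self_mem_nhdsWithin
  have hgt : ∀ᶠ s in 𝓝[>] x, x < s := self_mem_nhdsWithin
  have ha0 : 0 ≤ a := ge_of_tendsto ha' <| hgt.mono fun s hs =>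
    hf.monotoneOn.slope_nonneg hx (hx.trans hs)
  have hb0 : 0 ≤ b := ge_of_tendsto hb' <| (hpos.and hlt).mono fun s hs =>
    hf.monotoneOn.slope_nonneg hx hs.1
  have h1 : ∀ z s, 0 < z → z < s → s < x → slope f s x ^ 2 ≤ slope f z s * a := by
    intro z s hz hzs hsx
    refine le_of_tendsto_of_tendsto (((hcs s hsx.ne).mono_left nhdsWithin_le_nhds).pow 2)
      (ha'.const_mul _) ?_
    filter_upwards [hgt] with y hy
    exact hf.sq_slope_le_slope_mul_slope hz hzs hsx hy
  have h2 : ∀ z, 0 < z → z < x → b ^ 2 ≤ slope f z x * a := by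
    intro z hz hzx
    refine le_of_tendsto_of_tendsto (hb'.pow 2)
      (((hcs z hzx.ne).mono_left nhdsWithin_le_nhds).mul_const a) ?_
    filter_upwards [hlt, nhdsWithin_le_nhds (Ioi_mem_nhds hzx)] with s hsx hzs
    rw [slope_comm f x s]
    exact h1 z s hz hzs hsx
  have h3 : b ^ 2 ≤ b * a := by
    refine ge_of_tendsto (hb'.mul_const a) ?_
    filter_upwards [hpos, hlt] with z hz hzx
    rw [slope_comm f x z]
    exact h2 z hz hzx
  have hab : a ≤ b := by
    refine ge_of_tendsto hb' ?_
    filter_upwards [hpos, hlt] with z hz hzx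
    refine le_of_tendsto ha' ?_
    filter_upwards [hgt] with y hy
    rw [slope_comm f x z, slope_def_field, slope_def_field]
    exact hf.concaveOn.slope_anti_adjacent hz (hx.trans hy) hzx hy
  have hba : a = b := by nlinarith
  subst hba
  have h4 := hb.union ha
  rw [Set.Iio_union_Ioi] at h4
  exact (hasDerivAt_iff_tendsto_slope.2
    ((hasDerivWithinAt_iff_tendsto_slope' (by simp)).1 h4)).differentiableAt

end Loewner

/-! ### The commutator estimate for one function, and the theorem. -/

section Main

variable {n : ℕ} {N : Seminorm ℂ (Matrix (Fin n) (Fin n) ℂ)} {f : ℝ → ℝ}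

theorem IsUnitarilyInvariantNorm.apply_cfc_mul_sub_mul_cfc_le (hN : IsUnitarilyInvariantNorm N)
    (hf : OperatorMonotoneOn (Set.Ioi 0) f) {A B : Matrix (Fin n) (Fin n) ℂ} (hA : A.PosDef)
    (hB : B.PosDef) (X : Matrix (Fin n) (Fin n) ℂ) :
    N (cfc f A * X - X * cfc f B) ≤
      max (matrixOpNorm (cfc (deriv f) A)) (matrixOpNorm (cfc (deriv f) B)) *
        N (A * X - X * B) := by
  set c := max (matrixOpNorm (cfc (deriv f) A)) (matrixOpNorm (cfc (deriv f) B)) with hc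
  obtain ⟨U, hU, hUA⟩ := hA.isHermitian.exists_eq_unitary_mul_diagonal_mul_star
  obtain ⟨V, hV, hVB⟩ := hB.isHermitian.exists_eq_unitary_mul_diagonal_mul_star
  have ha0 : ∀ i, 0 < hA.isHermitian.eigenvalues i := hA.eigenvalues_pos
  have hb0 : ∀ i, 0 < hB.isHermitian.eigenvalues i := hB.eigenvalues_pos
  generalize hA.isHermitian.eigenvalues = a at hUA ha0
  generalize hB.isHermitian.eigenvalues = b at hVB hb0
  have hcA : ∀ h : ℝ → ℝ, cfc h A = U * Matrix.diagonal (fun i => (h (a i) : ℂ)) * star U :=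
    fun h => by rw [hUA]; exact cfc_unitary_mul_diagonal_mul_star hU a h
  have hcB : ∀ h : ℝ → ℝ, cfc h B = V * Matrix.diagonal (fun i => (h (b i) : ℂ)) * star V :=
    fun h => by rw [hVB]; exact cfc_unitary_mul_diagonal_mul_star hV b h
  have hda : ∀ i, deriv f (a i) ≤ c := fun i => by
    refine le_trans ?_ (le_max_left _ _)
    rw [hcA]
    refine le_trans ?_ (norm_apply_le_of_unitary_mul_diagonal_mul hU (Unitary.star_mem hU) _ i)
    rw [Complex.norm_real]
    exact le_abs_self _
  have hdb : ∀ i, deriv f (b i) ≤ c := fun i => by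
    refine le_trans ?_ (le_max_right _ _)
    rw [hcB]
    refine le_trans ?_ (norm_apply_le_of_unitary_mul_diagonal_mul hV (Unitary.star_mem hV) _ i)
    rw [Complex.norm_real]
    exact le_abs_self _
  -- Joining both spectra makes the rectangular array f[a i, b j] a block of one positive
  -- semidefinite matrix; the Gram vectors of its two diagonal blocks have squared lengths f'(a i)
  -- and f'(b j).
  have hx0 : ∀ i : Fin n ⊕ Fin n, 0 < Sum.elim a b i := by
    rintro (i | i)
    · exact ha0 i
    · exact hb0 i
  obtain ⟨m, v, hv⟩ := Matrix.posSemidef_iff_eq_sum_vecMulVec.1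
    (hf.posSemidef_dslope hx0 fun i => hf.differentiableAt (hx0 i))
  have hgram : ∀ i j, ((dslope f (Sum.elim a b i) (Sum.elim a b j) : ℝ) : ℂ) =
      ∑ k, v k i * star (v k j) := by
    intro i j
    have := congrFun (congrFun hv i) j
    simpa [Matrix.sum_apply, Matrix.vecMulVec_apply] using this
  have hdiag : ∀ i, ∑ k, ‖v k i‖ ^ 2 = deriv f (Sum.elim a b i) := by
    intro i
    have := hgram i i
    rw [dslope_same] at this
    simp only [Complex.star_def, Complex.mul_conj, Complex.normSq_eq_norm_sq] at this
    exact_mod_cast this.symm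
  have hschur := hN.apply_schur_le (fun k i => v k (Sum.inl i)) (fun k j => star (v k (Sum.inr j)))
    (c := c) ((matrixOpNorm_nonneg _).trans (le_max_left _ _))
    (fun i => by rw [hdiag]; exact hda i)
    (fun i => by simp only [norm_star]; rw [hdiag]; exact hdb i) (star U * (A * X - X * B) * V)
  have hconj : ∀ h : ℝ → ℝ, star U * (cfc h A * X - X * cfc h B) * V =
      Matrix.of fun i j => ((h (a i) : ℂ) - h (b j)) * (star U * X * V) i j := by
    intro h
    have : star U * (cfc h A * X - X * cfc h B) * V =
        Matrix.diagonal (fun i => (h (a i) : ℂ)) * (star U * X * V) -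
          (star U * X * V) * Matrix.diagonal (fun i => (h (b i) : ℂ)) := by
      rw [hcA, hcB]
      simp only [mul_sub, sub_mul, mul_assoc]
      rw [Matrix.mem_unitaryGroup_iff'.1 hV, mul_one, ← mul_assoc (star U) U,
        Matrix.mem_unitaryGroup_iff'.1 hU, one_mul]
    rw [this]
    ext i j
    simp only [Matrix.sub_apply, Matrix.mul_diagonal, Matrix.diagonal_mul, Matrix.of_apply]
    ring
  have hAB : star U * (A * X - X * B) * V =
      Matrix.of fun i j => ((a i : ℂ) - b j) * (star U * X * V) i j := by
    have := hconj id
    rwa [cfc_id ℝ A hA.isHermitian.isSelfAdjoint, cfc_id ℝ B hB.isHermitian.isSelfAdjoint] at this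
  have hlhs : (Matrix.of fun i j => (∑ k, v k (Sum.inl i) * star (v k (Sum.inr j))) *
      (star U * (A * X - X * B) * V) i j) = star U * (cfc f A * X - X * cfc f B) * V := by
    rw [hconj, hAB]
    ext i j
    simp only [Matrix.of_apply]
    rw [← hgram, ← mul_assoc]
    congr 1
    have := sub_smul_dslope f (a i) (b j)
    rw [smul_eq_mul] at this
    simp only [Sum.elim_inl, Sum.elim_inr]
    have h2 : ((b j : ℂ) - a i) * ((dslope f (a i) (b j) : ℝ) : ℂ) = f (b j) - f (a i) := by
      exact_mod_cast this
    linear_combination -h2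
  rw [hlhs] at hschur
  rwa [hN.apply_unitary_mul_mul_unitary _ _ (Unitary.star_mem hU) _ hV,
    hN.apply_unitary_mul_mul_unitary _ _ (Unitary.star_mem hU) _ hV] at hschur

end Main

theorem theorem2p7 (n : ℕ) (N : Seminorm ℂ (Matrix (Fin n) (Fin n) ℂ))
    (hN : IsUnitarilyInvariantNorm N) (A B X : Matrix (Fin n) (Fin n) ℂ)
    (hA : A.PosDef) (hB : B.PosDef) (f g : ℝ → ℝ)
    (hf : OperatorMonotoneOn (Set.Ioi 0) f) (hg : OperatorMonotoneOn (Set.Ioi 0) g) :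
    N (cfc f A * cfc g A * X - X * (cfc f B * cfc g B)) ≤
      N (A * X - X * B) *
        (max (matrixOpNorm (cfc (deriv f) A)) (matrixOpNorm (cfc (deriv f) B)) *
            max (matrixOpNorm (cfc g A)) (matrixOpNorm (cfc g B)) +
          max (matrixOpNorm (cfc f A)) (matrixOpNorm (cfc f B)) *
            max (matrixOpNorm (cfc (deriv g) A)) (matrixOpNorm (cfc (deriv g) B))) := by
  have hsplit : cfc f A * cfc g A * X - X * (cfc f B * cfc g B) =
      (cfc f A * X - X * cfc f B) * cfc g B + cfc f A * (cfc g A * X - X * cfc g B) := by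
    simp only [mul_sub, sub_mul, mul_assoc]
    abel
  have h1 := hN.apply_cfc_mul_sub_mul_cfc_le hf hA hB X
  have h2 := hN.apply_cfc_mul_sub_mul_cfc_le hg hA hB X
  rw [hsplit]
  calc N _ ≤ N ((cfc f A * X - X * cfc f B) * cfc g B) +
        N (cfc f A * (cfc g A * X - X * cfc g B)) := map_add_le_add N _ _
    _ ≤ N (cfc f A * X - X * cfc f B) * matrixOpNorm (cfc g B) +
        matrixOpNorm (cfc f A) * N (cfc g A * X - X * cfc g B) :=
      add_le_add (hN.apply_mul_le_right _ _) (hN.apply_mul_le_left _ _)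
    _ ≤ max (matrixOpNorm (cfc (deriv f) A)) (matrixOpNorm (cfc (deriv f) B)) *
          N (A * X - X * B) * max (matrixOpNorm (cfc g A)) (matrixOpNorm (cfc g B)) +
        max (matrixOpNorm (cfc f A)) (matrixOpNorm (cfc f B)) *
          (max (matrixOpNorm (cfc (deriv g) A)) (matrixOpNorm (cfc (deriv g) B)) *
            N (A * X - X * B)) :=
      add_le_add
        (mul_le_mul h1 (le_max_right _ _) (matrixOpNorm_nonneg _)
          ((apply_nonneg N _).trans h1))
        (mul_le_mul (le_max_left _ _) h2 (apply_nonneg N _)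
          ((matrixOpNorm_nonneg _).trans (le_max_left _ _)))
    _ = _ := by ring
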